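/- Let $P\subset\mathbb{R}^n$ be a set with interior $P_0$ (for instance the moment polytope of a toric Kähler manifold), and let $u:P_0\to\mathbb{R}$ be a smooth function whose Hessian $(u_{ij})=\big(\frac{\partial^2u}{\partial x_i\partial x_j}\big)$ is positive definite at every point of $P_0$ (for instance a symplectic potential). Let $(u^{ij})$ be the inverse matrix of $(u_{ij})$, put $F^{ab}_{kl}=-\frac{\partial^2u^{ab}}{\partial x_k\partial x_l}$, and let $|F|\ge 0$ be given by $$|F|^2=\sum F^{ij}_{kl}F^{ab}_{cd}\,u_{ia}u_{jb}u^{kc}u^{ld}.$$ Suppose that $|F|\le 1$ on $P_0$. Let $\gamma:(0,a)\to P_0$ be a geodesic of the Riemannian metric $\sum u_{ij}\,dx_i\,dx_j$, parameterized by arc length $t\in(0,a)$. Then for every fixed vector $\nu\in\mathbb{R}^n$ the function $$t\longmapsto\frac{\sqrt{\sum_{i,j}u^{ij}(\gamma(t))\,\nu_i\nu_j}}{\sinh t}$$ is non-increasing on $(0,a)$. -/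

import Mathlib

open scoped ContDiff Matrix

noncomputable section

namespace ToricGeodesic

/-- The partial derivative `∂f/∂x_i` at `x`. -/
def pderiv {n : ℕ} (i : Fin n) (f : (Fin n → ℝ) → ℝ) (x : Fin n → ℝ) : ℝ :=
  fderiv ℝ f x (Pi.single i 1)

/-- The Hessian matrix `u_{ij} = ∂²u/∂x_i∂x_j` at `x`; when it is positive definite it is the
matrix of the Riemannian metric `∑ u_{ij} dx_i dx_j`. -/
def hess {n : ℕ} (u : (Fin n → ℝ) → ℝ) (x : Fin n → ℝ) : Matrix (Fin n) (Fin n) ℝ :=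
  Matrix.of fun i j => pderiv i (pderiv j u) x

/-- The inverse Hessian `u^{ij}` at `x`. -/
def invHess {n : ℕ} (u : (Fin n → ℝ) → ℝ) (x : Fin n → ℝ) : Matrix (Fin n) (Fin n) ℝ :=
  (hess u x)⁻¹

/-- The curvature tensor `F^{ab}_{kl} = -∂²u^{ab}/∂x_k∂x_l` at `x`. -/
def tensorF {n : ℕ} (u : (Fin n → ℝ) → ℝ) (x : Fin n → ℝ) (a b k l : Fin n) : ℝ :=
  -pderiv k (pderiv l fun y => invHess u y a b) x

/-- The norm `|F|` at `x` taken with the metric `u_{ij}`, that is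
`|F|² = F^{ij}_{kl} F^{ab}_{cd} u_{ia} u_{jb} u^{kc} u^{ld}`. -/
def normF {n : ℕ} (u : (Fin n → ℝ) → ℝ) (x : Fin n → ℝ) : ℝ :=
  Real.sqrt (∑ i, ∑ j, ∑ k, ∑ l, ∑ a, ∑ b, ∑ c, ∑ d,
    tensorF u x i j k l * tensorF u x a b c d *
      hess u x i a * hess u x j b * invHess u x k c * invHess u x l d)

/-- The Christoffel symbol `Γ^k_{ij}` of the Levi-Civita connection of a metric `g`. -/
def christoffel {n : ℕ} (g : (Fin n → ℝ) → Matrix (Fin n) (Fin n) ℝ) (x : Fin n → ℝ)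
    (k i j : Fin n) : ℝ :=
  (1 / 2) * ∑ l, (g x)⁻¹ k l *
    (pderiv i (fun y => g y j l) x + pderiv j (fun y => g y i l) x - pderiv l (fun y => g y i j) x)

/-- `γ`, restricted to the interval `(0, a)`, is a geodesic of the metric `g` on `Ω`,
parameterized by arc length. -/
structure IsUnitSpeedGeodesic {n : ℕ} (Ω : Set (Fin n → ℝ))
    (g : (Fin n → ℝ) → Matrix (Fin n) (Fin n) ℝ) (a : ℝ) (γ : ℝ → Fin n → ℝ) : Prop where
  mem : ∀ t ∈ Set.Ioo 0 a, γ t ∈ Ω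
  contDiffOn : ContDiffOn ℝ 2 γ (Set.Ioo 0 a)
  geodesic_eq : ∀ t ∈ Set.Ioo 0 a, ∀ k,
    deriv (deriv γ) t k +
      ∑ i, ∑ j, christoffel g (γ t) k i j * deriv γ t i * deriv γ t j = 0
  unit_speed : ∀ t ∈ Set.Ioo 0 a, deriv γ t ⬝ᵥ (g (γ t) *ᵥ deriv γ t) = 1

end ToricGeodesic

end

namespace ToricGeodesic

open Set Filter Topology

/-! ### Partial derivatives -/

section PartialDerivatives

variable {n : ℕ} {s : Set (Fin n → ℝ)} {f g : (Fin n → ℝ) → ℝ} {x : Fin n → ℝ}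

lemma fderiv_apply_eq_sum_pderiv (f : (Fin n → ℝ) → ℝ) (x w : Fin n → ℝ) :
    fderiv ℝ f x w = ∑ i, pderiv i f x * w i := by
  have h := LinearMap.pi_apply_eq_sum_univ (fderiv ℝ f x).toLinearMap w
  simp only [ContinuousLinearMap.coe_coe, smul_eq_mul] at h
  rw [h]
  refine Finset.sum_congr rfl fun i _ => ?_
  rw [mul_comm, pderiv]
  congr 2
  ext j
  simp [Pi.single_apply, eq_comm]

lemma contDiffOn_pderiv (hs : IsOpen s) (hf : ContDiffOn ℝ ∞ f s) (i : Fin n) :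
    ContDiffOn ℝ ∞ (pderiv i f) s :=
  (hf.fderiv_of_isOpen hs (by simp)).clm_apply contDiffOn_const

lemma differentiableAt_of_contDiffOn (hs : IsOpen s) (hf : ContDiffOn ℝ ∞ f s) (hx : x ∈ s) :
    DifferentiableAt ℝ f x :=
  (hf.differentiableOn (by simp)).differentiableAt (hs.mem_nhds hx)

lemma pderiv_congr (hs : IsOpen s) (hfg : EqOn f g s) (hx : x ∈ s) (i : Fin n) :
    pderiv i f x = pderiv i g x := by
  rw [pderiv, pderiv, (hfg.eventuallyEq_of_mem (hs.mem_nhds hx)).fderiv_eq]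

lemma pderiv_comm (hs : IsOpen s) (hf : ContDiffOn ℝ ∞ f s) (hx : x ∈ s) (i j : Fin n) :
    pderiv i (pderiv j f) x = pderiv j (pderiv i f) x := by
  have hsymm : IsSymmSndFDerivAt ℝ f x :=
    (hf.contDiffAt (hs.mem_nhds hx)).isSymmSndFDerivAt (by
      simp only [minSmoothness_of_isRCLikeNormedField]
      exact WithTop.coe_le_coe.mpr le_top)
  have hd : DifferentiableAt ℝ (fderiv ℝ f) x :=
    ((hf.fderiv_of_isOpen (m := ∞) hs (by simp)).differentiableOn (by simp)).differentiableAt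
      (hs.mem_nhds hx)
  have key : ∀ k l : Fin n, pderiv k (pderiv l f) x =
      fderiv ℝ (fderiv ℝ f) x (Pi.single k 1) (Pi.single l 1) := by
    intro k l
    change fderiv ℝ (fun y => fderiv ℝ f y (Pi.single l 1)) x _ = _
    rw [fderiv_clm_apply hd (differentiableAt_const _)]
    simp
  rw [key, key, hsymm.eq]

lemma pderiv_sum_mul {m : ℕ} {f g : Fin m → (Fin n → ℝ) → ℝ}
    (hf : ∀ i, DifferentiableAt ℝ (f i) x) (hg : ∀ i, DifferentiableAt ℝ (g i) x) (k : Fin n) :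
    pderiv k (fun y => ∑ i, f i y * g i y) x =
      ∑ i, (pderiv k (f i) x * g i x + f i x * pderiv k (g i) x) := by
  have h : HasFDerivAt (fun y => ∑ i, f i y * g i y)
      (∑ i, (f i x • fderiv ℝ (g i) x + g i x • fderiv ℝ (f i) x)) x :=
    HasFDerivAt.fun_sum fun i _ => (hf i).hasFDerivAt.mul (hg i).hasFDerivAt
  rw [pderiv, h.fderiv]
  simp only [sum_apply, add_apply, smul_apply, smul_eq_mul, pderiv]
  exact Finset.sum_congr rfl fun i _ => by ring

end PartialDerivatives

/-! ### Partial derivatives of matrix-valued functions -/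

section MatrixDerivatives

variable {n : ℕ} {s : Set (Fin n → ℝ)} {x : Fin n → ℝ}
  {M N : (Fin n → ℝ) → Matrix (Fin n) (Fin n) ℝ}

/-- The entrywise partial derivative of a matrix-valued function. -/
noncomputable def matPderiv (k : Fin n) (M : (Fin n → ℝ) → Matrix (Fin n) (Fin n) ℝ) (x : Fin n → ℝ) :
    Matrix (Fin n) (Fin n) ℝ :=
  Matrix.of fun a b => pderiv k (fun y => M y a b) x

/-- All entries of a matrix-valued function are smooth on `s`. -/
def MatSmoothOn (M : (Fin n → ℝ) → Matrix (Fin n) (Fin n) ℝ) (s : Set (Fin n → ℝ)) : Prop :=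
  ∀ a b, ContDiffOn ℝ ∞ (fun y => M y a b) s

lemma MatSmoothOn.matPderiv (hs : IsOpen s) (hM : MatSmoothOn M s) (k : Fin n) :
    MatSmoothOn (matPderiv k M) s :=
  fun a b => contDiffOn_pderiv hs (hM a b) k

lemma MatSmoothOn.mul (hM : MatSmoothOn M s) (hN : MatSmoothOn N s) :
    MatSmoothOn (fun y => M y * N y) s := by
  intro a b
  simp only [Matrix.mul_apply]
  exact ContDiffOn.sum fun i _ => (hM a i).mul (hN i b)

lemma MatSmoothOn.det (hM : MatSmoothOn M s) : ContDiffOn ℝ ∞ (fun y => (M y).det) s := by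
  simp only [Matrix.det_apply']
  exact ContDiffOn.sum fun σ _ => contDiffOn_const.mul (contDiffOn_prod fun i _ => hM _ _)

lemma MatSmoothOn.inv (hM : MatSmoothOn M s) (hdet : ∀ y ∈ s, (M y).det ≠ 0) :
    MatSmoothOn (fun y => (M y)⁻¹) s := by
  intro a b
  simp only [Matrix.inv_def, Matrix.smul_apply, Ring.inverse_eq_inv', smul_eq_mul,
    Matrix.adjugate_apply]
  refine (hM.det.inv hdet).mul (MatSmoothOn.det ?_)
  intro i j
  by_cases h : i = b
  · subst h
    simpa using contDiffOn_const
  · simpa [Matrix.updateRow_ne h] using hM i j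

lemma matPderiv_congr (hs : IsOpen s) (h : EqOn M N s) (hx : x ∈ s) (k : Fin n) :
    matPderiv k M x = matPderiv k N x := by
  ext a b
  exact pderiv_congr hs (fun y hy => by simp only [h hy]) hx k

lemma matPderiv_mul (hs : IsOpen s) (hM : MatSmoothOn M s) (hN : MatSmoothOn N s) (hx : x ∈ s)
    (k : Fin n) :
    matPderiv k (fun y => M y * N y) x = matPderiv k M x * N x + M x * matPderiv k N x := by
  ext a b
  simp only [matPderiv, Matrix.of_apply, Matrix.mul_apply, Matrix.add_apply]
  rw [pderiv_sum_mul (fun i => differentiableAt_of_contDiffOn hs (hM a i) hx)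
    (fun i => differentiableAt_of_contDiffOn hs (hN i b) hx), Finset.sum_add_distrib]

lemma matPderiv_const (A : Matrix (Fin n) (Fin n) ℝ) (k : Fin n) :
    matPderiv k (fun _ => A) x = 0 := by
  ext a b
  simp [matPderiv, pderiv]

lemma matPderiv_neg (k : Fin n) :
    matPderiv k (fun y => -M y) x = -matPderiv k M x := by
  ext a b
  simp [matPderiv, pderiv]

lemma matPderiv_inv (hs : IsOpen s) (hM : MatSmoothOn M s) (hdet : ∀ y ∈ s, (M y).det ≠ 0)
    (hx : x ∈ s) (k : Fin n) :
    matPderiv k (fun y => (M y)⁻¹) x = -((M x)⁻¹ * matPderiv k M x * (M x)⁻¹) := by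
  have hu : ∀ y ∈ s, IsUnit (M y).det := fun y hy => isUnit_iff_ne_zero.mpr (hdet y hy)
  have h1 := matPderiv_mul hs (hM.inv hdet) hM hx k
  rw [matPderiv_congr hs (N := fun _ => 1)
    (fun y hy => Matrix.nonsing_inv_mul _ (hu y hy)) hx, matPderiv_const] at h1
  have h2 := congrArg (· * (M x)⁻¹) h1
  simp only [zero_mul, add_mul, Matrix.mul_assoc, Matrix.mul_nonsing_inv _ (hu x hx),
    mul_one] at h2
  rw [Matrix.mul_assoc]
  exact eq_neg_of_add_eq_zero_left h2.symm

lemma matPderiv_matPderiv_inv (hs : IsOpen s) (hM : MatSmoothOn M s)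
    (hdet : ∀ y ∈ s, (M y).det ≠ 0) (hx : x ∈ s) (k l : Fin n) :
    matPderiv k (matPderiv l fun y => (M y)⁻¹) x =
      (M x)⁻¹ * matPderiv k M x * (M x)⁻¹ * matPderiv l M x * (M x)⁻¹ +
      (M x)⁻¹ * matPderiv l M x * (M x)⁻¹ * matPderiv k M x * (M x)⁻¹ -
      (M x)⁻¹ * matPderiv k (matPderiv l M) x * (M x)⁻¹ := by
  have hI := hM.inv hdet
  rw [matPderiv_congr hs (N := fun y => -((M y)⁻¹ * matPderiv l M y * (M y)⁻¹))
    (fun y hy => matPderiv_inv hs hM hdet hy l) hx, matPderiv_neg,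
    matPderiv_mul hs (hI.mul (hM.matPderiv hs l)) hI hx,
    matPderiv_mul hs hI (hM.matPderiv hs l) hx, matPderiv_inv hs hM hdet hx]
  noncomm_ring

end MatrixDerivatives

/-! ### Cauchy–Schwarz for positive semidefinite matrices and tensors -/

section CauchySchwarz

open scoped Kronecker

lemma PosSemidef.sq_dotProduct_mulVec_le {ι : Type*} [Fintype ι] {M : Matrix ι ι ℝ}
    (hM : M.PosSemidef) (x y : ι → ℝ) :
    (x ⬝ᵥ M *ᵥ y) ^ 2 ≤ (x ⬝ᵥ M *ᵥ x) * (y ⬝ᵥ M *ᵥ y) := by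
  have hsymm : y ⬝ᵥ M *ᵥ x = x ⬝ᵥ M *ᵥ y := by
    have hT : Mᵀ = M := by simpa using hM.isHermitian.eq
    rw [Matrix.dotProduct_mulVec, ← Matrix.mulVec_transpose, hT, dotProduct_comm]
  have h : ∀ c : ℝ, 0 ≤ (y ⬝ᵥ M *ᵥ y) * (c * c) + (2 * (x ⬝ᵥ M *ᵥ y)) * c + x ⬝ᵥ M *ᵥ x := by
    intro c
    have h0 := hM.dotProduct_mulVec_nonneg (x + c • y)
    simp only [star_trivial, Matrix.mulVec_add, Matrix.mulVec_smul, dotProduct_add,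
      add_dotProduct, smul_dotProduct, dotProduct_smul, smul_eq_mul, hsymm] at h0
    linarith
  have hd := discrim_le_zero h
  rw [discrim] at hd
  linarith

/-- The tensor product of two vectors. -/
def vecTensor {ι κ : Type*} (x : ι → ℝ) (y : κ → ℝ) : ι × κ → ℝ :=
  fun p => x p.1 * y p.2

lemma kronecker_mulVec_vecTensor {ι κ : Type*} [Fintype ι] [Fintype κ] (A : Matrix ι ι ℝ)
    (B : Matrix κ κ ℝ) (x : ι → ℝ) (y : κ → ℝ) :
    (A ⊗ₖ B) *ᵥ vecTensor x y = vecTensor (A *ᵥ x) (B *ᵥ y) := by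
  ext p
  simp only [vecTensor, Matrix.mulVec, dotProduct, Fintype.sum_prod_type, Matrix.kroneckerMap_apply,
    Finset.sum_mul_sum]
  exact Finset.sum_congr rfl fun i _ => Finset.sum_congr rfl fun j _ => by ring

lemma vecTensor_dotProduct_vecTensor {ι κ : Type*} [Fintype ι] [Fintype κ] (x x' : ι → ℝ) (y y' : κ → ℝ) :
    vecTensor x y ⬝ᵥ vecTensor x' y' = (x ⬝ᵥ x') * (y ⬝ᵥ y') := by
  simp only [vecTensor, dotProduct, Fintype.sum_prod_type, Finset.sum_mul_sum]
  exact Finset.sum_congr rfl fun i _ => Finset.sum_congr rfl fun j _ => by ring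

/-- The contraction of a four-index tensor with four vectors is at most the product of the norms,
where the first two slots are measured with `G` and the last two with `G⁻¹`. -/
lemma sq_tensor_apply_le {n : ℕ} {G : Matrix (Fin n) (Fin n) ℝ} (hG : G.PosDef)
    (T : Fin n → Fin n → Fin n → Fin n → ℝ) (p q r s : Fin n → ℝ) :
    (∑ i, ∑ j, ∑ k, ∑ l, T i j k l * (p i * q j * (r k * s l))) ^ 2 ≤
      (p ⬝ᵥ G⁻¹ *ᵥ p) * (q ⬝ᵥ G⁻¹ *ᵥ q) * ((r ⬝ᵥ G *ᵥ r) * (s ⬝ᵥ G *ᵥ s)) *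
      ∑ i, ∑ j, ∑ k, ∑ l, ∑ a, ∑ b, ∑ c, ∑ d,
        T i j k l * T a b c d * G i a * G j b * G⁻¹ k c * G⁻¹ l d := by
  have hdet : IsUnit G.det := isUnit_iff_ne_zero.mpr hG.det_pos.ne'
  have h1 : ∀ v, G *ᵥ (G⁻¹ *ᵥ v) = v := fun v => by
    rw [Matrix.mulVec_mulVec, Matrix.mul_nonsing_inv _ hdet, Matrix.one_mulVec]
  have h2 : ∀ v, G⁻¹ *ᵥ (G *ᵥ v) = v := fun v => by
    rw [Matrix.mulVec_mulVec, Matrix.nonsing_inv_mul _ hdet, Matrix.one_mulVec]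
  have hK := ((hG.kronecker hG).kronecker (hG.inv.kronecker hG.inv)).posSemidef
  set K := (G ⊗ₖ G) ⊗ₖ (G⁻¹ ⊗ₖ G⁻¹) with hKdef
  set F : (Fin n × Fin n) × (Fin n × Fin n) → ℝ := fun z => T z.1.1 z.1.2 z.2.1 z.2.2 with hF
  set W := vecTensor (vecTensor (G⁻¹ *ᵥ p) (G⁻¹ *ᵥ q)) (vecTensor (G *ᵥ r) (G *ᵥ s)) with hW
  have hKW : K *ᵥ W = vecTensor (vecTensor p q) (vecTensor r s) := by
    simp only [hW, hKdef, kronecker_mulVec_vecTensor, h1, h2]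
  have hWW : W ⬝ᵥ K *ᵥ W =
      (p ⬝ᵥ G⁻¹ *ᵥ p) * (q ⬝ᵥ G⁻¹ *ᵥ q) * ((r ⬝ᵥ G *ᵥ r) * (s ⬝ᵥ G *ᵥ s)) := by
    rw [hKW, hW]
    simp only [vecTensor_dotProduct_vecTensor]
    rw [dotProduct_comm _ p, dotProduct_comm _ q, dotProduct_comm _ r, dotProduct_comm _ s]
  have hFW : F ⬝ᵥ K *ᵥ W = ∑ i, ∑ j, ∑ k, ∑ l, T i j k l * (p i * q j * (r k * s l)) := by
    rw [hKW]
    simp only [vecTensor, dotProduct, Fintype.sum_prod_type, hF]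
  have hFF : F ⬝ᵥ K *ᵥ F = ∑ i, ∑ j, ∑ k, ∑ l, ∑ a, ∑ b, ∑ c, ∑ d,
        T i j k l * T a b c d * G i a * G j b * G⁻¹ k c * G⁻¹ l d := by
    simp only [dotProduct, Matrix.mulVec, Fintype.sum_prod_type, hF, Finset.mul_sum, hKdef,
      Matrix.kroneckerMap_apply]
    refine Finset.sum_congr rfl fun i _ => Finset.sum_congr rfl fun j _ =>
      Finset.sum_congr rfl fun k _ => Finset.sum_congr rfl fun l _ =>
      Finset.sum_congr rfl fun a _ => Finset.sum_congr rfl fun b _ =>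
      Finset.sum_congr rfl fun c _ => Finset.sum_congr rfl fun d _ => ?_
    ring
  have h := PosSemidef.sq_dotProduct_mulVec_le hK F W
  rw [hFW, hFF, hWW] at h
  linarith

end CauchySchwarz

/-! ### A Riccati comparison theorem -/

section Riccati

variable {ι : Type*} [Fintype ι]

lemma hasDerivAt_dotProduct_mulVec {A : ℝ → Matrix ι ι ℝ} {A' : Matrix ι ι ℝ} {t : ℝ}
    (h : ∀ i j, HasDerivAt (fun s => A s i j) (A' i j) t) (v w : ι → ℝ) :
    HasDerivAt (fun s => v ⬝ᵥ A s *ᵥ w) (v ⬝ᵥ A' *ᵥ w) t := by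
  simp only [dotProduct, Matrix.mulVec]
  exact HasDerivAt.fun_sum fun i _ =>
    (HasDerivAt.fun_sum fun j _ => (h i j).mul_const (w j)).const_mul (v i)

lemma continuousOn_dotProduct_mulVec {A : ℝ → Matrix ι ι ℝ} {s : Set ℝ}
    (h : ∀ i j, ContinuousOn (fun t => A t i j) s) :
    ContinuousOn (fun z : ℝ × (ι → ℝ) => z.2 ⬝ᵥ A z.1 *ᵥ z.2) (s ×ˢ univ) := by
  have h' : ∀ i j, ContinuousOn (fun z : ℝ × (ι → ℝ) => A z.1 i j) (s ×ˢ univ) :=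
    fun i j => (h i j).comp continuousOn_fst fun z hz => hz.1
  simp only [dotProduct, Matrix.mulVec]
  exact continuousOn_finsetSum _ fun i _ => ((continuous_apply i).comp continuous_snd).continuousOn.mul
    (continuousOn_finsetSum _ fun j _ =>
      (h' i j).mul ((continuous_apply j).comp continuous_snd).continuousOn)

/-- A continuous path of symmetric matrices that starts negative definite stays so, provided that
its derivative is negative on the kernel whenever the matrix is negative semidefinite. -/
lemma neg_of_deriv_neg_on_kernel {N N' : ℝ → Matrix ι ι ℝ} {b c : ℝ} (hbc : b ≤ c)
    (hsymm : ∀ t ∈ Icc b c, (N t).IsHermitian)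
    (hd : ∀ t ∈ Icc b c, ∀ i j, HasDerivAt (fun s => N s i j) (N' t i j) t)
    (hb : ∀ v, v ≠ 0 → v ⬝ᵥ N b *ᵥ v < 0)
    (hker : ∀ t ∈ Icc b c, ∀ v, v ≠ 0 → N t *ᵥ v = 0 → v ⬝ᵥ N' t *ᵥ v < 0)
    (v : ι → ℝ) (hv : v ≠ 0) : v ⬝ᵥ N c *ᵥ v < 0 := by
  have hscale : ∀ t (r : ℝ) (w : ι → ℝ),
      (r • w) ⬝ᵥ N t *ᵥ (r • w) = r ^ 2 * (w ⬝ᵥ N t *ᵥ w) := by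
    intro t r w
    simp only [Matrix.mulVec_smul, smul_dotProduct, dotProduct_smul, smul_eq_mul]
    ring
  have hunit : ∀ w : ι → ℝ, w ≠ 0 → ∃ e ∈ Metric.sphere (0 : ι → ℝ) 1, w = ‖w‖ • e := by
    intro w hw
    have hw' : ‖w‖ ≠ 0 := norm_ne_zero_iff.mpr hw
    refine ⟨‖w‖⁻¹ • w, ?_, by rw [smul_smul, mul_inv_cancel₀ hw', one_smul]⟩
    simp [norm_smul, hw']
  have hcont : ContinuousOn (fun z : ℝ × (ι → ℝ) => z.2 ⬝ᵥ N z.1 *ᵥ z.2)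
      (Icc b c ×ˢ Metric.sphere 0 1) :=
    (continuousOn_dotProduct_mulVec fun i j t ht =>
      (hd t ht i j).continuousAt.continuousWithinAt).mono (prod_mono_right (subset_univ _))
  have hK : IsCompact ((Icc b c ×ˢ Metric.sphere (0 : ι → ℝ) 1) ∩
      (fun z : ℝ × (ι → ℝ) => z.2 ⬝ᵥ N z.1 *ᵥ z.2) ⁻¹' Ici 0) :=
    (isCompact_Icc.prod (isCompact_sphere _ _)).of_isClosed_subset
      (hcont.preimage_isClosed_of_isClosed (isClosed_Icc.prod Metric.isClosed_sphere) isClosed_Ici)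
      inter_subset_left
  by_contra! hcon
  obtain ⟨e, he, hve⟩ := hunit v hv
  have hne : ((Icc b c ×ˢ Metric.sphere (0 : ι → ℝ) 1) ∩
      (fun z : ℝ × (ι → ℝ) => z.2 ⬝ᵥ N z.1 *ᵥ z.2) ⁻¹' Ici 0).Nonempty := by
    refine ⟨(c, e), ⟨⟨hbc, le_rfl⟩, he⟩, ?_⟩
    rw [hve, hscale] at hcon
    exact nonneg_of_mul_nonneg_right hcon (by have := norm_pos_iff.mpr hv; positivity)
  obtain ⟨⟨τ, w⟩, ⟨⟨hτ, hw⟩, hτw⟩, hmin⟩ := hK.exists_isMinOn hne continuousOn_fst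
  simp only [mem_preimage, mem_Ici] at hτw hτ hw
  have hw0 : w ≠ 0 := by
    rintro rfl
    simp at hw
  have hbefore : ∀ t ∈ Ico b τ, ∀ e ∈ Metric.sphere (0 : ι → ℝ) 1, e ⬝ᵥ N t *ᵥ e < 0 := by
    intro t ht e he
    by_contra! hte
    have := hmin (show (t, e) ∈ _ from ⟨⟨⟨ht.1, ht.2.le.trans hτ.2⟩, he⟩, hte⟩)
    exact absurd ht.2 (not_lt.mpr this)
  have hbτ : b < τ := by
    refine lt_of_le_of_ne hτ.1 ?_
    rintro rfl
    exact absurd (hb w hw0) (not_lt.mpr hτw)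
  have hIoo : ∀ᶠ t in 𝓝[<] τ, t ∈ Ico b τ :=
    mem_of_superset (Ioo_mem_nhdsLT hbτ) Ioo_subset_Ico_self
  have hderiv := fun u : ι → ℝ => hasDerivAt_dotProduct_mulVec (hd τ hτ) u u
  have hle : ∀ e ∈ Metric.sphere (0 : ι → ℝ) 1, e ⬝ᵥ N τ *ᵥ e ≤ 0 := fun e he =>
    le_of_tendsto ((hderiv e).continuousAt.tendsto.mono_left nhdsWithin_le_nhds)
      (hIoo.mono fun t ht => (hbefore t ht e he).le)
  have hpsd : (-N τ).PosSemidef := by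
    refine Matrix.PosSemidef.of_dotProduct_mulVec_nonneg (hsymm τ hτ).neg fun u => ?_
    simp only [star_trivial, Matrix.neg_mulVec, dotProduct_neg, Left.nonneg_neg_iff]
    by_cases hu : u = 0
    · simp [hu]
    obtain ⟨e, he, hue⟩ := hunit u hu
    rw [hue, hscale]
    exact mul_nonpos_of_nonneg_of_nonpos (by positivity) (hle e he)
  have hzero : w ⬝ᵥ N τ *ᵥ w = 0 := le_antisymm (hle w hw) hτw
  have hNw : N τ *ᵥ w = 0 := by
    have := (hpsd.dotProduct_mulVec_zero_iff w).mp (by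
      simp [Matrix.neg_mulVec, hzero])
    simpa [Matrix.neg_mulVec] using this
  have hneg := hker τ hτ w hw0 hNw
  have hslope := (hasDerivAt_iff_tendsto_slope_left_right.mp (hderiv w)).1
  have hev : ∀ᶠ t in 𝓝[<] τ, slope (fun s => w ⬝ᵥ N s *ᵥ w) τ t < 0 :=
    hslope.eventually_lt_const hneg
  obtain ⟨t, ht, htI⟩ := (hev.and hIoo).exists
  rw [slope_def_field, hzero, sub_zero] at ht
  have h1 := hbefore t htI w hw
  have h2 : t - τ < 0 := sub_neg.mpr htI.2
  exact absurd ht (not_lt.mpr (div_nonneg_of_nonpos h1.le h2.le))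

variable [DecidableEq ι]

/-- If `H' = 2 S` and `S' < H + S H⁻¹ S` on `(0, a)` with `H` positive definite, then
`S ≤ coth t • H`. -/
theorem riccati_comparison {H S S' : ℝ → Matrix ι ι ℝ} {a : ℝ}
    (hH : ∀ t ∈ Ioo 0 a, (H t).PosDef) (hS : ∀ t ∈ Ioo 0 a, (S t).IsHermitian)
    (hHd : ∀ t ∈ Ioo 0 a, ∀ i j, HasDerivAt (fun s => H s i j) (2 * S t i j) t)
    (hSd : ∀ t ∈ Ioo 0 a, ∀ i j, HasDerivAt (fun s => S s i j) (S' t i j) t)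
    (hineq : ∀ t ∈ Ioo 0 a, ∀ v, v ≠ 0 → v ⬝ᵥ S' t *ᵥ v <
      v ⬝ᵥ H t *ᵥ v + (S t *ᵥ v) ⬝ᵥ (H t)⁻¹ *ᵥ (S t *ᵥ v))
    {t : ℝ} (ht : t ∈ Ioo 0 a) (v : ι → ℝ) :
    Real.sinh t * (v ⬝ᵥ S t *ᵥ v) ≤ Real.cosh t * (v ⬝ᵥ H t *ᵥ v) := by
  by_cases hv : v = 0
  · simp [hv]
  have key : ∀ b ∈ Ioo 0 t,
      Real.sinh (t - b) * (v ⬝ᵥ S t *ᵥ v) ≤ Real.cosh (t - b) * (v ⬝ᵥ H t *ᵥ v) := by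
    intro b hb
    have hsub : Icc b t ⊆ Ioo 0 a := fun r hr => ⟨hb.1.trans_le hr.1, hr.2.trans_lt ht.2⟩
    have h := neg_of_deriv_neg_on_kernel
      (N := fun r => Real.sinh (r - b) • S r - Real.cosh (r - b) • H r)
      (N' := fun r => (Real.cosh (r - b) • S r + Real.sinh (r - b) • S' r) -
        (Real.sinh (r - b) • H r + Real.cosh (r - b) • (2 : ℝ) • S r)) hb.2.le ?_ ?_ ?_ ?_ v hv
    · simp only [Matrix.sub_mulVec, Matrix.smul_mulVec, dotProduct_sub, dotProduct_smul,
        smul_eq_mul] at h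
      linarith
    · intro r hr
      exact ((hS r (hsub hr)).smul (IsSelfAdjoint.all _)).sub
        ((hH r (hsub hr)).isHermitian.smul (IsSelfAdjoint.all _))
    · intro r hr i j
      simp only [Matrix.sub_apply, Matrix.add_apply, Matrix.smul_apply, smul_eq_mul]
      have e : HasDerivAt (fun r : ℝ => r - b) 1 r := (hasDerivAt_id r).sub_const b
      have e1 := e.sinh.mul (hSd r (hsub hr) i j)
      have e2 := e.cosh.mul (hHd r (hsub hr) i j)
      simp only [mul_one] at e1 e2
      exact e1.sub e2
    · intro w hw
      have := (hH b (hsub ⟨le_rfl, hb.2.le⟩)).dotProduct_mulVec_pos hw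
      simpa [Matrix.neg_mulVec] using this
    · intro r hr w hw hN
      have hr' := hsub hr
      set sh := Real.sinh (r - b)
      set ch := Real.cosh (r - b)
      have hch : 0 < ch := Real.cosh_pos _
      have hSw : sh • (S r *ᵥ w) = ch • (H r *ᵥ w) := by
        simpa [Matrix.sub_mulVec, Matrix.smul_mulVec, sub_eq_zero] using hN
      have hpos : 0 < w ⬝ᵥ H r *ᵥ w := by
        simpa using (hH r hr').dotProduct_mulVec_pos hw
      have hsh : 0 < sh := by
        refine lt_of_le_of_ne (Real.sinh_nonneg_iff.mpr (sub_nonneg.mpr hr.1)) fun h0 => ?_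
        rw [← h0, zero_smul] at hSw
        have := congrArg (w ⬝ᵥ ·) hSw
        simp only [dotProduct_zero, dotProduct_smul, smul_eq_mul] at this
        exact absurd this (mul_pos hch hpos).ne
      have hSw' : S r *ᵥ w = (ch / sh) • (H r *ᵥ w) := by
        rw [div_eq_inv_mul, mul_smul, ← hSw, smul_smul, inv_mul_cancel₀ hsh.ne', one_smul]
      have hinv : (H r)⁻¹ *ᵥ (H r *ᵥ w) = w := by
        rw [Matrix.mulVec_mulVec, Matrix.nonsing_inv_mul _
          (isUnit_iff_ne_zero.mpr (hH r hr').det_pos.ne'), Matrix.one_mulVec]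
      have h := hineq r hr' w hw
      rw [hSw', Matrix.mulVec_smul, hinv, dotProduct_smul, smul_dotProduct,
        dotProduct_comm (H r *ᵥ w)] at h
      simp only [Matrix.sub_mulVec, Matrix.add_mulVec, Matrix.smul_mulVec, dotProduct_sub,
        dotProduct_add, dotProduct_smul, hSw', smul_eq_mul] at h ⊢
      have h' := mul_lt_mul_of_pos_left h hsh
      have hs : sh * (ch / sh) = ch := mul_div_cancel₀ _ hsh.ne'
      have h3 : sh * (ch / sh * (ch / sh * (w ⬝ᵥ H r *ᵥ w))) = ch * (ch / sh * (w ⬝ᵥ H r *ᵥ w)) := by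
        rw [← mul_assoc, hs]
      linarith
  have hlim : ∀ {f : ℝ → ℝ}, Continuous f → ∀ r : ℝ,
      Tendsto (fun b => f (t - b) * r) (𝓝[>] 0) (𝓝 (f t * r)) := by
    intro f hf r
    have : Continuous fun b => f (t - b) * r := by fun_prop
    simpa using (this.tendsto 0).mono_left nhdsWithin_le_nhds
  exact le_of_tendsto_of_tendsto (hlim Real.continuous_sinh _) (hlim Real.continuous_cosh _)
    (mem_of_superset (Ioo_mem_nhdsGT ht.1) key)

end Riccati

/-! ### Contractions and the Jacobi identity for the inverse Hessian -/

section Contractions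

variable {n : ℕ}

/-- The contraction `∑ₖ Zₖ Uₖ`. -/
def contract (U : Fin n → Matrix (Fin n) (Fin n) ℝ) (Z : Fin n → ℝ) : Matrix (Fin n) (Fin n) ℝ :=
  ∑ k, Z k • U k

/-- The contraction `∑ₖₗ Zₖ Wₗ Dₖₗ`. -/
def contractTwo (D : Fin n → Fin n → Matrix (Fin n) (Fin n) ℝ) (Z W : Fin n → ℝ) :
    Matrix (Fin n) (Fin n) ℝ :=
  ∑ k, ∑ l, (Z k * W l) • D k l

lemma contract_apply (U : Fin n → Matrix (Fin n) (Fin n) ℝ) (Z : Fin n → ℝ) (i j : Fin n) :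
    contract U Z i j = ∑ k, Z k * U k i j := by
  simp [contract, Matrix.sum_apply]

lemma contractTwo_apply (D : Fin n → Fin n → Matrix (Fin n) (Fin n) ℝ) (Z W : Fin n → ℝ)
    (i j : Fin n) : contractTwo D Z W i j = ∑ k, ∑ l, Z k * W l * D k l i j := by
  simp [contractTwo, Matrix.sum_apply]

lemma dotProduct_contractTwo_mulVec (D : Fin n → Fin n → Matrix (Fin n) (Fin n) ℝ)
    (p q r s : Fin n → ℝ) :
    p ⬝ᵥ contractTwo D r s *ᵥ q =
      ∑ i, ∑ j, ∑ k, ∑ l, D k l i j * (p i * q j * (r k * s l)) := by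
  simp only [dotProduct, Matrix.mulVec, contractTwo_apply, Finset.sum_mul, Finset.mul_sum]
  refine Finset.sum_congr rfl fun i _ => Finset.sum_congr rfl fun j _ =>
    Finset.sum_congr rfl fun k _ => Finset.sum_congr rfl fun l _ => ?_
  ring

lemma contract_neg_mul_mul (H : Matrix (Fin n) (Fin n) ℝ) (U : Fin n → Matrix (Fin n) (Fin n) ℝ)
    (Z : Fin n → ℝ) :
    contract (fun k => -(H * U k * H)) Z = -(H * contract U Z * H) := by
  simp only [contract, Finset.mul_sum, Finset.sum_mul, smul_neg, Finset.sum_neg_distrib,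
    Matrix.mul_smul, Matrix.smul_mul]

lemma contract_mul_mul_contract (H : Matrix (Fin n) (Fin n) ℝ)
    (U : Fin n → Matrix (Fin n) (Fin n) ℝ) (Z W : Fin n → ℝ) :
    contract U Z * H * contract U W = contractTwo (fun k l => U k * H * U l) Z W := by
  simp only [contract, contractTwo, Finset.mul_sum, Finset.sum_mul, Matrix.mul_smul,
    Matrix.smul_mul, smul_smul]
  rw [Finset.sum_comm]
  simp only [mul_comm]

lemma contractTwo_eq (H : Matrix (Fin n) (Fin n) ℝ) (U : Fin n → Matrix (Fin n) (Fin n) ℝ)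
    (Q D : Fin n → Fin n → Matrix (Fin n) (Fin n) ℝ)
    (hD : ∀ k l, D k l = H * U k * H * U l * H + H * U l * H * U k * H - H * Q k l * H)
    (Z W : Fin n → ℝ) :
    contractTwo D Z W = H * (contract U Z * H * contract U W) * H +
      H * (contract U W * H * contract U Z) * H - H * contractTwo Q Z W * H := by
  have hswap : contractTwo (fun k l => U k * H * U l) W Z =
      ∑ k, ∑ l, (Z k * W l) • (U l * H * U k) := by
    rw [contractTwo, Finset.sum_comm]
    simp only [mul_comm]
  rw [contract_mul_mul_contract, contract_mul_mul_contract, hswap]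
  simp only [contractTwo, hD, Finset.mul_sum, Finset.sum_mul, Matrix.mul_smul, Matrix.smul_mul,
    smul_add, smul_sub, Finset.sum_add_distrib, Finset.sum_sub_distrib, Matrix.mul_assoc]

lemma contract_mulVec_comm {U : Fin n → Matrix (Fin n) (Fin n) ℝ}
    (hU : ∀ k i j, U k i j = U j i k) (Z W : Fin n → ℝ) :
    contract U Z *ᵥ W = contract U W *ᵥ Z := by
  ext i
  simp only [Matrix.mulVec, dotProduct, contract_apply, Finset.sum_mul]
  rw [Finset.sum_comm]
  refine Finset.sum_congr rfl fun k _ => Finset.sum_congr rfl fun j _ => ?_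
  rw [hU]
  ring

lemma transpose_contract {U : Fin n → Matrix (Fin n) (Fin n) ℝ}
    (hU : ∀ k i j, U k i j = U k j i) (Z : Fin n → ℝ) : (contract U Z)ᵀ = contract U Z := by
  ext i j
  simp only [Matrix.transpose_apply, contract_apply]
  exact Finset.sum_congr rfl fun k _ => by rw [hU]

lemma dotProduct_mulVec_comm_of_symm {A : Matrix (Fin n) (Fin n) ℝ} (hA : Aᵀ = A)
    (v w : Fin n → ℝ) : v ⬝ᵥ A *ᵥ w = (A *ᵥ v) ⬝ᵥ w := by
  rw [Matrix.dotProduct_mulVec, ← Matrix.mulVec_transpose, hA]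

/-- The second derivative of `H = G⁻¹` along a curve with velocity `X` and acceleration
`-½ H (∂G(X) X)`, in terms of two curvature contractions and a term quadratic in `∂G`. -/
lemma jacobi_identity {G H : Matrix (Fin n) (Fin n) ℝ} (hH : Hᵀ = H) (hHG : H * G = 1)
    {U : Fin n → Matrix (Fin n) (Fin n) ℝ} (hU : ∀ k i j, U k i j = U k j i)
    (hU' : ∀ k i j, U k i j = U j i k)
    {Q : Fin n → Fin n → Matrix (Fin n) (Fin n) ℝ} (hQ : ∀ k l i j, Q k l i j = Q k j i l)
    {D : Fin n → Fin n → Matrix (Fin n) (Fin n) ℝ}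
    (hD : ∀ k l, D k l = H * U k * H * U l * H + H * U l * H * U k * H - H * Q k l * H)
    (X v : Fin n → ℝ) :
    v ⬝ᵥ (contractTwo D X X + contract (fun k => -(H * U k * H))
        (-((1 / 2 : ℝ) • H *ᵥ (contract U X *ᵥ X)))) *ᵥ v =
      1 / 2 * (v ⬝ᵥ contractTwo D X X *ᵥ v) + 1 / 2 * (v ⬝ᵥ contractTwo D X (H *ᵥ v) *ᵥ (G *ᵥ X)) +
      1 / 2 * ((contract U X *ᵥ (H *ᵥ v)) ⬝ᵥ H *ᵥ (contract U X *ᵥ (H *ᵥ v))) := by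
  have hHGX : H *ᵥ (G *ᵥ X) = X := by rw [Matrix.mulVec_mulVec, hHG, Matrix.one_mulVec]
  have hT := transpose_contract hU
  have hQ' : ∀ Y, Y ⬝ᵥ contractTwo Q X Y *ᵥ X = Y ⬝ᵥ contractTwo Q X X *ᵥ Y := by
    intro Y
    rw [dotProduct_contractTwo_mulVec, dotProduct_contractTwo_mulVec]
    refine Finset.sum_congr rfl fun i _ => ?_
    refine Finset.sum_comm.trans (Eq.trans (Finset.sum_congr rfl fun k _ => ?_) Finset.sum_comm)
    refine Finset.sum_comm.trans (Finset.sum_congr rfl fun j _ => Finset.sum_congr rfl fun l _ => ?_)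
    rw [hQ]
    ring
  rw [contract_neg_mul_mul, contractTwo_eq H U Q D hD, contractTwo_eq H U Q D hD]
  simp only [Matrix.add_mulVec, Matrix.sub_mulVec, Matrix.neg_mulVec, ← Matrix.mulVec_mulVec,
    hHGX, dotProduct_add, dotProduct_sub, dotProduct_neg, dotProduct_mulVec_comm_of_symm hH v]
  set Y := H *ᵥ v
  rw [hQ', contract_mulVec_comm hU' Y X,
    contract_mulVec_comm hU' (-((1 / 2 : ℝ) • H *ᵥ (contract U X *ᵥ X))) Y]
  simp only [dotProduct_mulVec_comm_of_symm (hT _) Y, Matrix.mulVec_neg, Matrix.mulVec_smul,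
    dotProduct_neg, dotProduct_smul, smul_eq_mul]
  ring

end Contractions

/-! ### The inverse Hessian along a geodesic -/

section Geodesic

variable {n : ℕ} {s : Set (Fin n → ℝ)} {u : (Fin n → ℝ) → ℝ} {x : Fin n → ℝ}

lemma matSmoothOn_hess (hs : IsOpen s) (hu : ContDiffOn ℝ ∞ u s) : MatSmoothOn (hess u) s :=
  fun i j => contDiffOn_pderiv hs (contDiffOn_pderiv hs hu j) i

lemma matPderiv_hess_symm (hs : IsOpen s) (hu : ContDiffOn ℝ ∞ u s) (hx : x ∈ s) (k i j : Fin n) :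
    matPderiv k (hess u) x i j = matPderiv k (hess u) x j i :=
  pderiv_congr hs (fun _ hy => pderiv_comm hs hu hy i j) hx k

lemma matPderiv_hess_comm (hs : IsOpen s) (hu : ContDiffOn ℝ ∞ u s) (hx : x ∈ s) (k i j : Fin n) :
    matPderiv k (hess u) x i j = matPderiv j (hess u) x i k := by
  have h1 : matPderiv k (hess u) x i j = matPderiv k (hess u) x j i :=
    matPderiv_hess_symm hs hu hx k i j
  have h2 : matPderiv k (hess u) x j i = matPderiv j (hess u) x k i :=
    pderiv_comm hs (contDiffOn_pderiv hs hu i) hx k j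
  rw [h1, h2, matPderiv_hess_symm hs hu hx]

lemma matPderiv_matPderiv_hess_comm (hs : IsOpen s) (hu : ContDiffOn ℝ ∞ u s) (hx : x ∈ s)
    (k l i j : Fin n) :
    matPderiv k (matPderiv l (hess u)) x i j = matPderiv k (matPderiv j (hess u)) x i l :=
  pderiv_congr hs (fun _ hy => matPderiv_hess_comm hs hu hy l i j) hx k

lemma christoffel_hess (hs : IsOpen s) (hu : ContDiffOn ℝ ∞ u s) (hx : x ∈ s) (k i j : Fin n) :
    christoffel (hess u) x k i j =
      1 / 2 * ∑ l, (hess u x)⁻¹ k l * matPderiv j (hess u) x l i := by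
  rw [christoffel]
  congr 1
  refine Finset.sum_congr rfl fun l _ => ?_
  have h1 : pderiv i (fun y => hess u y j l) x = matPderiv j (hess u) x l i := by
    exact (matPderiv_hess_symm hs hu hx i j l).trans (matPderiv_hess_comm hs hu hx i l j)
  have h2 : pderiv j (fun y => hess u y i l) x = matPderiv j (hess u) x l i :=
    matPderiv_hess_symm hs hu hx j i l
  have h3 : pderiv l (fun y => hess u y i j) x = matPderiv j (hess u) x l i :=
    (matPderiv_hess_comm hs hu hx l i j).trans (matPderiv_hess_symm hs hu hx j i l)
  rw [h1, h2, h3]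
  ring

lemma sum_christoffel_hess (hs : IsOpen s) (hu : ContDiffOn ℝ ∞ u s) (hx : x ∈ s)
    (X : Fin n → ℝ) (k : Fin n) :
    ∑ i, ∑ j, christoffel (hess u) x k i j * X i * X j =
      ((1 / 2 : ℝ) • (hess u x)⁻¹ *ᵥ (contract (fun k => matPderiv k (hess u) x) X *ᵥ X)) k := by
  simp only [christoffel_hess hs hu hx, Pi.smul_apply, smul_eq_mul, Matrix.mulVec, dotProduct,
    contract_apply, Finset.mul_sum, Finset.sum_mul]
  refine (Finset.sum_congr rfl fun i _ => Finset.sum_comm).trans (Finset.sum_comm.trans ?_)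
  refine Finset.sum_congr rfl fun l _ => Finset.sum_congr rfl fun i _ =>
    Finset.sum_congr rfl fun j _ => ?_
  ring

lemma hasDerivAt_comp_pderiv {f : (Fin n → ℝ) → ℝ} (hs : IsOpen s) (hf : ContDiffOn ℝ ∞ f s)
    {γ : ℝ → Fin n → ℝ} {X : Fin n → ℝ} {t : ℝ} (ht : γ t ∈ s) (hγ : HasDerivAt γ X t) :
    HasDerivAt (fun r => f (γ r)) (∑ k, X k * pderiv k f (γ t)) t := by
  have h := (differentiableAt_of_contDiffOn hs hf ht).hasFDerivAt.comp_hasDerivAt t hγ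
  rw [fderiv_apply_eq_sum_pderiv] at h
  refine h.congr_deriv ?_
  simp only [mul_comm]

lemma sq_contractTwo_le (hG : (hess u x).PosDef) (hF : normF u x ≤ 1) (p q r s : Fin n → ℝ) :
    (p ⬝ᵥ contractTwo (fun k l => matPderiv k (matPderiv l (invHess u)) x) r s *ᵥ q) ^ 2 ≤
      (p ⬝ᵥ (hess u x)⁻¹ *ᵥ p) * (q ⬝ᵥ (hess u x)⁻¹ *ᵥ q) *
        ((r ⬝ᵥ hess u x *ᵥ r) * (s ⬝ᵥ hess u x *ᵥ s)) := by
  have hN : (∑ i, ∑ j, ∑ k, ∑ l, ∑ a, ∑ b, ∑ c, ∑ d,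
    tensorF u x i j k l * tensorF u x a b c d *
      hess u x i a * hess u x j b * (hess u x)⁻¹ k c * (hess u x)⁻¹ l d) ≤ 1 := by
    simpa [normF, invHess, Real.sqrt_le_left] using hF
  have h := sq_tensor_apply_le hG (tensorF u x) p q r s
  have h0 : ∀ v, 0 ≤ v ⬝ᵥ hess u x *ᵥ v := fun v => by
    simpa using hG.posSemidef.dotProduct_mulVec_nonneg v
  have h0' : ∀ v, 0 ≤ v ⬝ᵥ (hess u x)⁻¹ *ᵥ v := fun v => by
    simpa using hG.inv.posSemidef.dotProduct_mulVec_nonneg v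
  have hneg : p ⬝ᵥ contractTwo (fun k l => matPderiv k (matPderiv l (invHess u)) x) r s *ᵥ q =
      -∑ i, ∑ j, ∑ k, ∑ l, tensorF u x i j k l * (p i * q j * (r k * s l)) := by
    simp only [dotProduct_contractTwo_mulVec, ← Finset.sum_neg_distrib]
    refine Finset.sum_congr rfl fun i _ => Finset.sum_congr rfl fun j _ =>
      Finset.sum_congr rfl fun k _ => Finset.sum_congr rfl fun l _ => ?_
    change _ = -(-matPderiv k (matPderiv l (invHess u)) x i j * _)
    ring
  rw [hneg, neg_sq]
  refine h.trans (mul_le_of_le_one_right ?_ hN)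
  exact mul_nonneg (mul_nonneg (h0' p) (h0' q)) (mul_nonneg (h0 r) (h0 s))

/-- Half of the first derivative of the inverse Hessian along a curve. -/
noncomputable def halfDeriv (u : (Fin n → ℝ) → ℝ) (γ : ℝ → Fin n → ℝ) (t : ℝ) :
    Matrix (Fin n) (Fin n) ℝ :=
  (1 / 2 : ℝ) • contract (fun k => matPderiv k (invHess u) (γ t)) (deriv γ t)

/-- Half of the second derivative of the inverse Hessian along a curve. -/
noncomputable def halfSecondDeriv (u : (Fin n → ℝ) → ℝ) (γ : ℝ → Fin n → ℝ) (t : ℝ) :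
    Matrix (Fin n) (Fin n) ℝ :=
  (1 / 2 : ℝ) • (contractTwo (fun k l => matPderiv k (matPderiv l (invHess u)) (γ t))
    (deriv γ t) (deriv γ t) +
    contract (fun k => matPderiv k (invHess u) (γ t)) (deriv (deriv γ) t))

lemma hasDerivAt_invHess (hs : IsOpen s) (hI : MatSmoothOn (invHess u) s)
    {γ : ℝ → Fin n → ℝ} {t : ℝ} (ht : γ t ∈ s) (hγ : DifferentiableAt ℝ γ t) (i j : Fin n) :
    HasDerivAt (fun r => invHess u (γ r) i j) (2 * halfDeriv u γ t i j) t := by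
  refine (hasDerivAt_comp_pderiv hs (hI i j) ht hγ.hasDerivAt).congr_deriv ?_
  simp [halfDeriv, contract_apply, matPderiv]

lemma hasDerivAt_halfDeriv (hs : IsOpen s) (hI : MatSmoothOn (invHess u) s)
    {γ : ℝ → Fin n → ℝ} {t : ℝ} (ht : γ t ∈ s) (hγ : DifferentiableAt ℝ γ t)
    (hγ' : DifferentiableAt ℝ (deriv γ) t) (i j : Fin n) :
    HasDerivAt (fun r => halfDeriv u γ r i j) (halfSecondDeriv u γ t i j) t := by
  simp only [halfDeriv, Matrix.smul_apply, contract_apply, smul_eq_mul]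
  have h : HasDerivAt
      (fun r => 1 / 2 * ∑ k, deriv γ r k * matPderiv k (invHess u) (γ r) i j)
      (1 / 2 * ∑ k, (deriv (deriv γ) t k * matPderiv k (invHess u) (γ t) i j +
        deriv γ t k * ∑ l, deriv γ t l * matPderiv l (matPderiv k (invHess u)) (γ t) i j)) t :=
    (HasDerivAt.fun_sum fun k _ => (hasDerivAt_pi.mp hγ'.hasDerivAt k).mul
      (hasDerivAt_comp_pderiv hs (hI.matPderiv hs k i j) ht hγ.hasDerivAt)).const_mul _
  refine h.congr_deriv ?_
  simp only [halfSecondDeriv, Matrix.smul_apply, Matrix.add_apply, contract_apply,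
    contractTwo_apply, smul_eq_mul, Finset.sum_add_distrib, Finset.mul_sum]
  rw [add_comm, Finset.sum_comm]
  simp only [mul_add, Finset.mul_sum, mul_assoc, mul_left_comm]

lemma isHermitian_invHess (hG : (hess u x).PosDef) : (invHess u x).IsHermitian :=
  hG.inv.isHermitian

/-- The Riccati inequality for the inverse Hessian along a unit-speed geodesic. -/
lemma halfSecondDeriv_lt (hs : IsOpen s) (hu : ContDiffOn ℝ ∞ u s)
    (hconv : ∀ x ∈ s, (hess u x).PosDef) (hF : ∀ x ∈ s, normF u x ≤ 1) {a : ℝ}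
    {γ : ℝ → Fin n → ℝ} (hγ : IsUnitSpeedGeodesic s (hess u) a γ) {t : ℝ} (ht : t ∈ Ioo 0 a)
    {v : Fin n → ℝ} (hv : v ≠ 0) :
    v ⬝ᵥ halfSecondDeriv u γ t *ᵥ v < v ⬝ᵥ invHess u (γ t) *ᵥ v +
      (halfDeriv u γ t *ᵥ v) ⬝ᵥ (invHess u (γ t))⁻¹ *ᵥ (halfDeriv u γ t *ᵥ v) := by
  have hx := hγ.mem t ht
  have hunit := hγ.unit_speed t ht
  have hgeo := hγ.geodesic_eq t ht
  have hdet : ∀ y ∈ s, (hess u y).det ≠ 0 := fun y hy => (hconv y hy).det_pos.ne'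
  have hM := matSmoothOn_hess hs hu
  have hD := matPderiv_matPderiv_inv hs hM hdet hx
  have hD1 := matPderiv_inv hs hM hdet hx
  have hsq := sq_contractTwo_le (hconv _ hx) (hF _ hx)
  have hpos : 0 < v ⬝ᵥ (hess u (γ t))⁻¹ *ᵥ v := by
    simpa using (hconv _ hx).inv.dotProduct_mulVec_pos hv
  have hdetu : IsUnit (hess u (γ t)).det := isUnit_iff_ne_zero.mpr (hdet _ hx)
  have hHG : (hess u (γ t))⁻¹ * hess u (γ t) = 1 := Matrix.nonsing_inv_mul _ hdetu
  have hGH : hess u (γ t) * (hess u (γ t))⁻¹ = 1 := Matrix.mul_nonsing_inv _ hdetu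
  have hHT : ((hess u (γ t))⁻¹)ᵀ = (hess u (γ t))⁻¹ := by
    simpa using (hconv _ hx).inv.isHermitian.eq
  have hinv : (invHess u (γ t))⁻¹ = hess u (γ t) := Matrix.nonsing_inv_nonsing_inv _ hdetu
  have hacc : deriv (deriv γ) t = -((1 / 2 : ℝ) • (hess u (γ t))⁻¹ *ᵥ
      (contract (fun k => matPderiv k (hess u) (γ t)) (deriv γ t) *ᵥ deriv γ t)) := by
    ext k
    rw [Pi.neg_apply, ← sum_christoffel_hess hs hu hx]
    exact eq_neg_of_add_eq_zero_left (hgeo k)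
  have hjac := jacobi_identity hHT hHG (matPderiv_hess_symm hs hu hx)
    (matPderiv_hess_comm hs hu hx) (matPderiv_matPderiv_hess_comm hs hu hx) hD (deriv γ t) v
  have hsec : halfSecondDeriv u γ t = (1 / 2 : ℝ) •
      (contractTwo (fun k l => matPderiv k (matPderiv l (invHess u)) (γ t))
        (deriv γ t) (deriv γ t) +
      contract (fun k => -((hess u (γ t))⁻¹ * matPderiv k (hess u) (γ t) * (hess u (γ t))⁻¹))
        (-((1 / 2 : ℝ) • (hess u (γ t))⁻¹ *ᵥ
          (contract (fun k => matPderiv k (hess u) (γ t)) (deriv γ t) *ᵥ deriv γ t)))) := by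
    rw [halfSecondDeriv, hacc]
    congr 3
    exact funext hD1
  have hfirst : halfDeriv u γ t *ᵥ v = -((1 / 2 : ℝ) • (hess u (γ t))⁻¹ *ᵥ
      (contract (fun k => matPderiv k (hess u) (γ t)) (deriv γ t) *ᵥ
        ((hess u (γ t))⁻¹ *ᵥ v))) := by
    have : halfDeriv u γ t = (1 / 2 : ℝ) • contract (fun k => -((hess u (γ t))⁻¹ *
        matPderiv k (hess u) (γ t) * (hess u (γ t))⁻¹)) (deriv γ t) := by
      rw [halfDeriv]
      congr 2
      exact funext hD1
    rw [this, contract_neg_mul_mul]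
    simp only [Matrix.smul_mulVec, Matrix.neg_mulVec, Matrix.mulVec_mulVec, smul_neg,
      Matrix.mul_assoc]
  have hF1 := hsq v v (deriv γ t) (deriv γ t)
  have hF2 := hsq v (hess u (γ t) *ᵥ deriv γ t) (deriv γ t) ((hess u (γ t))⁻¹ *ᵥ v)
  simp only [hunit, mul_one] at hF1
  rw [Matrix.mulVec_mulVec _ (hess u (γ t))⁻¹, hHG, Matrix.one_mulVec,
    Matrix.mulVec_mulVec _ (hess u (γ t)), hGH, Matrix.one_mulVec, hunit,
    dotProduct_comm (hess u (γ t) *ᵥ deriv γ t), hunit, dotProduct_comm _ v, mul_one, one_mul]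
    at hF2
  have hq : (halfDeriv u γ t *ᵥ v) ⬝ᵥ hess u (γ t) *ᵥ (halfDeriv u γ t *ᵥ v) =
      1 / 4 * ((contract (fun k => matPderiv k (hess u) (γ t)) (deriv γ t) *ᵥ
        ((hess u (γ t))⁻¹ *ᵥ v)) ⬝ᵥ (hess u (γ t))⁻¹ *ᵥ
        (contract (fun k => matPderiv k (hess u) (γ t)) (deriv γ t) *ᵥ
        ((hess u (γ t))⁻¹ *ᵥ v))) := by
    rw [hfirst]
    set z := contract (fun k => matPderiv k (hess u) (γ t)) (deriv γ t) *ᵥ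
        ((hess u (γ t))⁻¹ *ᵥ v)
    simp only [Matrix.mulVec_neg, Matrix.mulVec_smul, dotProduct_neg, neg_dotProduct,
      smul_dotProduct, dotProduct_smul, smul_eq_mul]
    rw [Matrix.mulVec_mulVec _ (hess u (γ t)), hGH, Matrix.one_mulVec, dotProduct_comm _ z]
    ring
  rw [hinv, hq, hsec, Matrix.smul_mulVec, dotProduct_smul, smul_eq_mul]
  have hF1' := abs_le_of_sq_le_sq' (hF1.trans_eq (sq _).symm) hpos.le
  have hF2' := abs_le_of_sq_le_sq' (hF2.trans_eq (sq _).symm) hpos.le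
  change _ < v ⬝ᵥ (hess u (γ t))⁻¹ *ᵥ v + _
  change v ⬝ᵥ (contractTwo (fun k l => matPderiv k (matPderiv l (invHess u)) (γ t)) _ _ + _) *ᵥ v =
    1 / 2 * (v ⬝ᵥ contractTwo (fun k l => matPderiv k (matPderiv l (invHess u)) (γ t)) _ _ *ᵥ v) +
    1 / 2 * (v ⬝ᵥ contractTwo (fun k l => matPderiv k (matPderiv l (invHess u)) (γ t)) _ _ *ᵥ _) +
    _ at hjac
  rw [hjac]
  linarith [hF1'.2, hF2'.2]

end Geodesic

end ToricGeodesic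

open ToricGeodesic in
theorem mainTheorem6 {n : ℕ} (P : Set (Fin n → ℝ)) (u : (Fin n → ℝ) → ℝ)
    (hu : ContDiffOn ℝ ∞ u (interior P))
    (hconv : ∀ x ∈ interior P, (ToricGeodesic.hess u x).PosDef)
    (hF : ∀ x ∈ interior P, ToricGeodesic.normF u x ≤ 1)
    (a : ℝ) (γ : ℝ → Fin n → ℝ)
    (hγ : ToricGeodesic.IsUnitSpeedGeodesic (interior P) (ToricGeodesic.hess u) a γ)
    (ν : Fin n → ℝ) :
    AntitoneOn
      (fun t : ℝ => Real.sqrt (ν ⬝ᵥ (ToricGeodesic.invHess u (γ t) *ᵥ ν)) / Real.sinh t)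
      (Set.Ioo 0 a) := by
  have hs : IsOpen (interior P) := isOpen_interior
  have hI : MatSmoothOn (invHess u) (interior P) :=
    (matSmoothOn_hess hs hu).inv fun y hy => (hconv y hy).det_pos.ne'
  have hγ1 : ∀ t ∈ Set.Ioo 0 a, DifferentiableAt ℝ γ t := fun t ht =>
    (hγ.contDiffOn.differentiableOn (by simp)).differentiableAt (Ioo_mem_nhds ht.1 ht.2)
  have hγ2 : ∀ t ∈ Set.Ioo 0 a, DifferentiableAt ℝ (deriv γ) t := fun t ht =>
    ((hγ.contDiffOn.deriv_of_isOpen (m := 1) isOpen_Ioo (by norm_num)).differentiableOn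
      (by simp)).differentiableAt (Ioo_mem_nhds ht.1 ht.2)
  have hHd : ∀ t ∈ Set.Ioo 0 a, ∀ i j, HasDerivAt (fun r => invHess u (γ r) i j)
      (2 * halfDeriv u γ t i j) t :=
    fun t ht => hasDerivAt_invHess hs hI (hγ.mem t ht) (hγ1 t ht)
  have hSsymm : ∀ t ∈ Set.Ioo 0 a, (halfDeriv u γ t).IsHermitian := by
    intro t ht
    ext i j
    have hev : (fun r => invHess u (γ r) i j) =ᶠ[nhds t] fun r => invHess u (γ r) j i :=
      Filter.eventuallyEq_of_mem (Ioo_mem_nhds ht.1 ht.2) fun r hr => by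
        simpa using (isHermitian_invHess (hconv _ (hγ.mem r hr))).apply j i
    have := (hHd t ht i j).unique ((hHd t ht j i).congr_of_eventuallyEq hev)
    simp only [Matrix.conjTranspose_apply, star_trivial]
    linarith
  have hric : ∀ t ∈ Set.Ioo 0 a, Real.sinh t * (ν ⬝ᵥ halfDeriv u γ t *ᵥ ν) ≤
      Real.cosh t * (ν ⬝ᵥ invHess u (γ t) *ᵥ ν) := fun t ht =>
    riccati_comparison (fun r hr => (hconv _ (hγ.mem r hr)).inv) hSsymm hHd
      (fun r hr => hasDerivAt_halfDeriv hs hI (hγ.mem r hr) (hγ1 r hr) (hγ2 r hr))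
      (fun r hr v hv => halfSecondDeriv_lt hs hu hconv hF hγ hr hv) ht ν
  have hsinh : ∀ t ∈ Set.Ioo 0 a, 0 < Real.sinh t := fun t ht => Real.sinh_pos_iff.mpr ht.1
  have hquot : ∀ t ∈ Set.Ioo 0 a, HasDerivAt
      (fun r => (ν ⬝ᵥ invHess u (γ r) *ᵥ ν) / Real.sinh r ^ 2)
      (((ν ⬝ᵥ ((2 : ℝ) • halfDeriv u γ t) *ᵥ ν) * Real.sinh t ^ 2 -
        (ν ⬝ᵥ invHess u (γ t) *ᵥ ν) * (2 * Real.sinh t * Real.cosh t)) /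
        (Real.sinh t ^ 2) ^ 2) t := by
    intro t ht
    have h1 := hasDerivAt_dotProduct_mulVec (A' := (2 : ℝ) • halfDeriv u γ t) (hHd t ht) ν ν
    have h2 := (Real.hasDerivAt_sinh t).pow 2
    refine (h1.div h2 (pow_ne_zero 2 (hsinh t ht).ne')).congr_deriv ?_
    simp
  have hanti : AntitoneOn (fun r => (ν ⬝ᵥ invHess u (γ r) *ᵥ ν) / Real.sinh r ^ 2)
      (Set.Ioo 0 a) := by
    refine antitoneOn_of_deriv_nonpos (convex_Ioo 0 a)
      (fun t ht => (hquot t ht).continuousAt.continuousWithinAt)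
      (fun t ht => (hquot t (interior_subset ht)).differentiableAt.differentiableWithinAt)
      fun t ht => ?_
    have ht' := interior_subset ht
    rw [(hquot t ht').deriv, Matrix.smul_mulVec, dotProduct_smul, smul_eq_mul]
    refine div_nonpos_of_nonpos_of_nonneg ?_ (by positivity)
    have := mul_le_mul_of_nonneg_left (hric t ht') (hsinh t ht').le
    linarith
  intro r hr t ht hrt
  have h := Real.sqrt_le_sqrt (hanti hr ht hrt)
  simpa only [Real.sqrt_div' _ (sq_nonneg _), Real.sqrt_sq (hsinh _ hr).le,
    Real.sqrt_sq (hsinh _ ht).le] using h
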